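/- Let $V$ be a finite set of wireless nodes placed at points of the Euclidean plane, and let $G=(V,E)$ be the link graph determined by a common maximum transmission range $R$: two distinct nodes $u,v$ are linked if and only if their Euclidean distance $d_{(u,v)}$ is at most $R$ (on a finite node set a large $R$ gives the complete graph). Fix a real $\alpha\ge 2$ and give each link $(u,v)\in E$ the weight $d_{(u,v)}^\alpha$. Let $M\subseteq V$ be the set of group members, and assume that $M$ does not consist of just two linked nodes. A multicast tree for $M$ is a subgraph $T$ of $G$ that is a tree and whose node set contains $M$. Write $\mathit{nb}(u,T)$ for the set of neighbours of $u$ in $T$, $\mathit{in}(T)$ for the set of nodes whose degree in $T$ is more than one, $\lambda(u,T)=\max\{d_{(u,v)}^\alpha : v\in \mathit{nb}(u,T)\}$ and $\Theta(T)=\sum_{u\in \mathit{in}(T)}\lambda(u,T)$. Let $T_W$ be a multicast tree for $M$ for which $\Theta(T_W)$ is minimum among all multicast trees for $M$. Let $\ddot T_S$ be a 2-approximate Steiner tree in $G$ spanning $M$, that is, a multicast tree for $M$ whose total link weight is at most twice the minimum total link weight of a multicast tree for $M$. Then $$\Theta(\ddot T_S)\le 48\,\Theta(T_W).$$ -/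

import Mathlib

noncomputable section

/-- Link graph of a network whose nodes share one maximum transmission range `R`: two distinct nodes
are linked exactly when their Euclidean distance is at most `R`. On a finite node set, a large `R`
gives the complete graph. -/
def IsRangeGraph {V : Type*} (G : SimpleGraph V) (pos : V → EuclideanSpace ℝ (Fin 2)) : Prop :=
  ∃ R : ℝ, ∀ u v : V, G.Adj u v ↔ u ≠ v ∧ dist (pos u) (pos v) ≤ R

/-- Energy needed to send a packet between `u` and `v`: the weight `d(u,v) ^ α`. -/
def txEnergy {V : Type*} (pos : V → EuclideanSpace ℝ (Fin 2)) (α : ℝ) (u v : V) : ℝ :=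
  dist (pos u) (pos v) ^ α

/-- The weight of a link, seen as an unordered pair of nodes. -/
def linkWeight {V : Type*} (pos : V → EuclideanSpace ℝ (Fin 2)) (α : ℝ) (e : Sym2 V) : ℝ :=
  Sym2.lift ⟨txEnergy pos α, fun u v => by simp only [txEnergy, dist_comm]⟩ e

/-- A multicast tree for `M` in `G`: a subgraph of `G` that is a tree and contains `M`
(it may use further nodes of `G`). -/
def IsMulticastTree {V : Type*} {G : SimpleGraph V} (M : Set V) (T : G.Subgraph) : Prop :=
  T.coe.IsTree ∧ M ⊆ T.verts

/-- Internal nodes: the nodes whose degree in `T` is more than one. -/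
def internalNodes {V : Type*} {G : SimpleGraph V} (T : G.Subgraph) : Set V :=
  {u | 1 < (T.neighborSet u).ncard}

/-- `λ(u,T)`: the largest weight of a link of `T` at `u`. -/
def nodePower {V : Type*} {G : SimpleGraph V} (pos : V → EuclideanSpace ℝ (Fin 2)) (α : ℝ)
    (T : G.Subgraph) (u : V) : ℝ :=
  sSup (txEnergy pos α u '' T.neighborSet u)

open scoped Classical in
/-- `Θ(T)`: the sum of `λ(u,T)` over the internal nodes `u` of `T`. -/
def totalPower {V : Type*} [Fintype V] {G : SimpleGraph V}
    (pos : V → EuclideanSpace ℝ (Fin 2)) (α : ℝ) (T : G.Subgraph) : ℝ :=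
  ∑ u ∈ (internalNodes T).toFinset, nodePower pos α T u

open scoped Classical in
/-- `ζ(T)`: the sum of the weights of the links of `T`. -/
def treeWeight {V : Type*} [Fintype V] {G : SimpleGraph V}
    (pos : V → EuclideanSpace ℝ (Fin 2)) (α : ℝ) (T : G.Subgraph) : ℝ :=
  ∑ e ∈ T.edgeSet.toFinset, linkWeight pos α e

/-- A multicast tree for `M` that minimizes `Θ` among all of them. -/
def IsMinPowerTree {V : Type*} [Fintype V] {G : SimpleGraph V}
    (pos : V → EuclideanSpace ℝ (Fin 2)) (α : ℝ) (M : Set V) (T : G.Subgraph) : Prop :=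
  IsMulticastTree M T ∧
    ∀ T' : G.Subgraph, IsMulticastTree M T' → totalPower pos α T ≤ totalPower pos α T'

/-- A tree in `G` spanning `M` whose weight is at most twice that of every tree in `G` spanning `M`,
that is, at most twice the weight of a minimum Steiner tree. -/
def IsTwoApproxSteinerTree {V : Type*} [Fintype V] {G : SimpleGraph V}
    (pos : V → EuclideanSpace ℝ (Fin 2)) (α : ℝ) (M : Set V) (T : G.Subgraph) : Prop :=
  IsMulticastTree M T ∧
    ∀ T' : G.Subgraph, IsMulticastTree M T' → treeWeight pos α T ≤ 2 * treeWeight pos α T'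

end

/-!
Every link has two ends, so `Θ(T) ≤ 2 ζ(T)` for every tree `T`. As `ζ(T_S)` is at most twice the
weight of any multicast tree, it suffices to find one of weight at most `8 Θ(T_W)`; the constant
reached is `2 * 2 * 8 = 32`.

Such a tree is found star by star. An internal node `u` of `T_W` pays `r ^ α`, where `r` is the
distance to its farthest neighbour. It is enough to join `u` and its neighbours by links no longer
than `r` (all of them links of `G`, as `r` is at most the range) whose squared lengths sum up to at
most `8 * r ^ 2` (`exists_links_sum_sq_le`). Every link of `T_W` has an internal end unless `T_W` is
a single link, so the links chosen for all the stars connect the nodes of `T_W`, and contain the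
links of a multicast tree. If `T_W` is a single link, then `M` has at most one node, and a tree of weight
zero exists.

The bound for a star is an area argument. Kruskal's algorithm merges a closest pair of clusters at a
time, and at threshold `t` the `t / 2`-neighbourhoods of the clusters are disjoint. With `κ` the
area of the unit disc, each cluster `P` keeps the invariant
`κ * (∑ |e| ^ 2 + t ^ 2) ≤ 4 * area (thickening (t / 2) P)` (`HasLightLinks`). It survives a merge
because areas add up (`HasLightLinks.union`), and it survives an increase of `t` because the area of
the `r`-neighbourhood of a finite set grows at least as fast as `κ * r ^ 2`
(`volume_annulus_le_thickening`). At the end `t = r`, and the neighbourhood of the star lies in a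
disc of radius `3 * r / 2`.
-/

open MeasureTheory Metric

/-! ### Growth of neighbourhoods of finite planar sets -/

/-- The normal cone at `p` of the convex hull of `S`: the directions in which no point of `S` lies
further out than `p`. -/
def outwardCone (S : Set (EuclideanSpace ℝ (Fin 2))) (p : EuclideanSpace ℝ (Fin 2)) :
    Set (EuclideanSpace ℝ (Fin 2)) :=
  {x | ∀ q ∈ S, inner ℝ (q - p) x ≤ 0}

lemma isClosed_outwardCone (S : Set (EuclideanSpace ℝ (Fin 2))) (p : EuclideanSpace ℝ (Fin 2)) :
    IsClosed (outwardCone S p) := by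
  have : outwardCone S p = ⋂ q ∈ S, {x | inner ℝ (q - p) x ≤ 0} := by
    ext x; simp [outwardCone]
  rw [this]
  refine isClosed_biInter fun q _ => isClosed_le ?_ continuous_const
  fun_prop

lemma exists_mem_outwardCone {S : Finset (EuclideanSpace ℝ (Fin 2))} (hS : S.Nonempty)
    (x : EuclideanSpace ℝ (Fin 2)) : ∃ p ∈ S, x ∈ outwardCone S p := by
  obtain ⟨p, hp, h⟩ := S.exists_max_image (fun q => inner ℝ q x) hS
  refine ⟨p, hp, fun q hq => ?_⟩
  rw [inner_sub_left]
  exact sub_nonpos.2 (h q hq)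

/-- Translating each cone to its apex gives pairwise disjoint sets: the nearest point of the convex
hull of `S` to a point of `p + outwardCone S p` is `p`. -/
lemma eq_of_add_outwardCone {S : Set (EuclideanSpace ℝ (Fin 2))}
    {p q x y : EuclideanSpace ℝ (Fin 2)} (hp : p ∈ S) (hq : q ∈ S) (hx : x ∈ outwardCone S p)
    (hy : y ∈ outwardCone S q) (h : p + x = q + y) : p = q := by
  have h1 := hx q hq
  have h2 := hy p hp
  have h3 : x - y = q - p := by
    rw [sub_eq_sub_iff_add_eq_add, add_comm x p, h]
  have h4 : inner ℝ (q - p) (x - y) ≤ 0 := by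
    rw [inner_sub_right]
    have : inner ℝ (p - q) y = - inner ℝ (q - p) y := by rw [← inner_neg_left, neg_sub]
    linarith
  rw [h3, real_inner_self_eq_norm_sq] at h4
  have : ‖q - p‖ = 0 := by nlinarith [norm_nonneg (q - p)]
  exact (sub_eq_zero.1 (norm_eq_zero.1 this)).symm

lemma norm_le_dist_of_mem_outwardCone {S : Set (EuclideanSpace ℝ (Fin 2))}
    {p q x : EuclideanSpace ℝ (Fin 2)} (hq : q ∈ S) (hx : x ∈ outwardCone S p) :
    ‖x‖ ≤ dist (p + x) q := by
  have h1 := hx q hq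
  rw [dist_eq_norm]
  have h2 : ‖x‖ ^ 2 ≤ ‖p + x - q‖ ^ 2 := by
    have : p + x - q = x - (q - p) := by abel
    rw [this, norm_sub_sq_real, real_inner_comm]
    nlinarith [sq_nonneg ‖q - p‖]
  exact le_of_sq_le_sq h2 (norm_nonneg _)

lemma volume_real_ball (p : EuclideanSpace ℝ (Fin 2)) {r : ℝ} (hr : 0 ≤ r) :
    volume.real (ball p r) =
      volume.real (ball (0 : EuclideanSpace ℝ (Fin 2)) 1) * r ^ 2 := by
  rw [measureReal_def, Measure.addHaar_ball _ _ hr, ENNReal.toReal_mul, finrank_euclideanSpace_fin,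
    ENNReal.toReal_ofReal (by positivity), measureReal_def, mul_comm]

lemma volume_real_unitBall_pos :
    0 < volume.real (ball (0 : EuclideanSpace ℝ (Fin 2)) 1) :=
  ENNReal.toReal_pos (measure_ball_pos _ _ one_pos).ne' measure_ball_lt_top.ne

lemma volume_thickening_ne_top (S : Finset (EuclideanSpace ℝ (Fin 2))) (r : ℝ) :
    volume (thickening r (S : Set (EuclideanSpace ℝ (Fin 2)))) ≠ ⊤ :=
  (S.finite_toSet.isBounded.thickening).measure_lt_top.ne

/-- The annulus is cut along the normal cones of `S`; each piece, translated to the apex of its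
cone, lies in the part of the larger neighbourhood outside the smaller one. -/
lemma volume_annulus_le_thickening_sdiff {S : Finset (EuclideanSpace ℝ (Fin 2))}
    (hS : S.Nonempty) (r s : ℝ) :
    volume (ball (0 : EuclideanSpace ℝ (Fin 2)) s \ ball 0 r) ≤
      volume (thickening s (S : Set (EuclideanSpace ℝ (Fin 2))) \
        thickening r (S : Set (EuclideanSpace ℝ (Fin 2)))) := by
  have hm (p) : MeasurableSet (outwardCone S p ∩
      (ball (0 : EuclideanSpace ℝ (Fin 2)) s \ ball 0 r)) :=
    (isClosed_outwardCone _ _).measurableSet.inter (measurableSet_ball.diff measurableSet_ball)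
  have hdisj : (S : Set (EuclideanSpace ℝ (Fin 2))).PairwiseDisjoint fun p =>
      (fun x => p + x) '' (outwardCone S p ∩ (ball 0 s \ ball 0 r)) := by
    intro p hp q hq hpq
    refine Set.disjoint_left.2 ?_
    rintro _ ⟨x, hx, rfl⟩ ⟨y, hy, hxy⟩
    exact hpq (eq_of_add_outwardCone hp hq hx.1 hy.1 hxy.symm)
  have hcover : ball (0 : EuclideanSpace ℝ (Fin 2)) s \ ball 0 r ⊆
      ⋃ p ∈ S, (outwardCone S p ∩ (ball 0 s \ ball 0 r)) := fun x hx => by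
    obtain ⟨p, hp, h⟩ := exists_mem_outwardCone hS x
    exact Set.mem_biUnion (x := p) hp ⟨h, hx⟩
  calc volume (ball (0 : EuclideanSpace ℝ (Fin 2)) s \ ball 0 r)
      ≤ ∑ p ∈ S, volume (outwardCone S p ∩ (ball 0 s \ ball 0 r)) :=
        (measure_mono hcover).trans (measure_biUnion_finset_le _ _)
    _ = ∑ p ∈ S, volume ((fun x => p + x) '' (outwardCone S p ∩ (ball 0 s \ ball 0 r))) := by
        refine Finset.sum_congr rfl fun p _ => ?_
        rw [Set.image_add_left, measure_preimage_add]
    _ = volume (⋃ p ∈ S, (fun x => p + x) '' (outwardCone S p ∩ (ball 0 s \ ball 0 r))) :=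
        (measure_biUnion_finset hdisj fun p _ =>
          (measurableEmbedding_addLeft p).measurableSet_image.2 (hm p)).symm
    _ ≤ _ := by
        refine measure_mono (Set.iUnion₂_subset fun p hp => ?_)
        rintro _ ⟨x, ⟨hx, hx1, hx2⟩, rfl⟩
        refine ⟨mem_thickening_iff.2 ⟨p, hp, by simpa [dist_eq_norm] using hx1⟩, fun h => ?_⟩
        obtain ⟨q, hq, hlt⟩ := mem_thickening_iff.1 h
        exact hx2 (mem_ball_zero_iff.2 ((norm_le_dist_of_mem_outwardCone hq hx).trans_lt hlt))

/-- As the radius grows, the neighbourhood of a finite set gains at least as much area as a single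
disc does. -/
lemma volume_annulus_le_thickening {S : Finset (EuclideanSpace ℝ (Fin 2))} (hS : S.Nonempty)
    {r s : ℝ} (hr : 0 ≤ r) (hrs : r ≤ s) :
    volume.real (ball (0 : EuclideanSpace ℝ (Fin 2)) 1) * (s ^ 2 - r ^ 2) ≤
      volume.real (thickening s (S : Set (EuclideanSpace ℝ (Fin 2)))) -
        volume.real (thickening r (S : Set (EuclideanSpace ℝ (Fin 2)))) := by
  rw [mul_sub, ← volume_real_ball 0 (hr.trans hrs), ← volume_real_ball 0 hr,
    ← measureReal_sdiff (ball_subset_ball hrs) measurableSet_ball measure_ball_lt_top.ne,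
    ← measureReal_sdiff (thickening_mono hrs _) isOpen_thickening.measurableSet
      (volume_thickening_ne_top S s)]
  exact ENNReal.toReal_mono (ne_top_of_le_ne_top (volume_thickening_ne_top S s)
    (measure_mono Set.sdiff_subset)) (volume_annulus_le_thickening_sdiff hS r s)

/-! ### Agglomerating clusters of nodes -/

lemma linkWeight_mk {V : Type*} (pos : V → EuclideanSpace ℝ (Fin 2)) (α : ℝ) (u v : V) :
    linkWeight pos α s(u, v) = dist (pos u) (pos v) ^ α := rfl

lemma linkWeight_nonneg {V : Type*} (pos : V → EuclideanSpace ℝ (Fin 2)) (α : ℝ) (e : Sym2 V) :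
    0 ≤ linkWeight pos α e := by
  induction e with
  | _ u v => exact Real.rpow_nonneg dist_nonneg _

/-- The links `E` join all nodes of `P` and have length at most `t`. They need not form a tree, and
may pass through nodes outside `P`. -/
structure LinksCluster {V : Type*} (pos : V → EuclideanSpace ℝ (Fin 2)) (P : Set V) (t : ℝ)
    (E : Finset (Sym2 V)) : Prop where
  ne_and_dist_le : ∀ u v, s(u, v) ∈ E → u ≠ v ∧ dist (pos u) (pos v) ≤ t
  reachable : ∀ u ∈ P, ∀ v ∈ P, (SimpleGraph.fromEdgeSet (E : Set (Sym2 V))).Reachable u v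

/-- The nodes of `P` can be joined by links of length at most `t` whose squared lengths, summed up
together with `t ^ 2`, are controlled by the area of the `t / 2`-neighbourhood of `P`. For a single
node and no links the bound is an equality. -/
def HasLightLinks {V : Type*} (pos : V → EuclideanSpace ℝ (Fin 2)) (P : Finset V) (t : ℝ) :
    Prop :=
  ∃ E : Finset (Sym2 V), LinksCluster pos P t E ∧
    volume.real (ball (0 : EuclideanSpace ℝ (Fin 2)) 1) * (∑ e ∈ E, linkWeight pos 2 e + t ^ 2) ≤
      4 * volume.real (thickening (t / 2) (pos '' P))

lemma hasLightLinks_singleton {V : Type*} (pos : V → EuclideanSpace ℝ (Fin 2)) (v : V) :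
    HasLightLinks pos {v} 0 := by
  refine ⟨∅, ⟨by simp, ?_⟩, by simp⟩
  simp

lemma HasLightLinks.mono {V : Type*} {pos : V → EuclideanSpace ℝ (Fin 2)} {P : Finset V}
    {s t : ℝ} (h : HasLightLinks pos P s) (hP : P.Nonempty) (hs : 0 ≤ s) (hst : s ≤ t) :
    HasLightLinks pos P t := by
  classical
  obtain ⟨E, hE, hb⟩ := h
  refine ⟨E, ⟨fun u v huv => ?_, hE.reachable⟩, ?_⟩
  · exact ⟨(hE.ne_and_dist_le u v huv).1, (hE.ne_and_dist_le u v huv).2.trans hst⟩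
  · have := volume_annulus_le_thickening (hP.image pos) (r := s / 2) (s := t / 2)
      (by linarith) (by linarith)
    rw [Finset.coe_image] at this
    linarith

lemma Finset.sum_union_le {ι : Type*} [DecidableEq ι] {f : ι → ℝ} (hf : ∀ i, 0 ≤ f i)
    (s t : Finset ι) : ∑ i ∈ s ∪ t, f i ≤ ∑ i ∈ s, f i + ∑ i ∈ t, f i := by
  rw [← Finset.sum_union_inter]
  exact le_add_of_nonneg_right (Finset.sum_nonneg fun i _ => hf i)

/-- Two clusters at distance exactly `t` merge: their `t / 2`-neighbourhoods are disjoint, so the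
areas add up, and the `t ^ 2` saved on one side pays for the new link. -/
lemma HasLightLinks.union {V : Type*} [DecidableEq V] {pos : V → EuclideanSpace ℝ (Fin 2)}
    {P Q : Finset V} {t : ℝ} (hP : HasLightLinks pos P t) (hQ : HasLightLinks pos Q t)
    (hsep : ∀ u ∈ P, ∀ v ∈ Q, t ≤ dist (pos u) (pos v)) {a b : V} (ha : a ∈ P) (hb : b ∈ Q)
    (hne : a ≠ b) (hab : dist (pos a) (pos b) = t) : HasLightLinks pos (P ∪ Q) t := by
  obtain ⟨E, hE, hEb⟩ := hP
  obtain ⟨F, hF, hFb⟩ := hQ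
  refine ⟨insert s(a, b) (E ∪ F), ⟨?_, ?_⟩, ?_⟩
  · intro u v huv
    rcases Finset.mem_insert.1 huv with h | h
    · rcases Sym2.eq_iff.1 h with ⟨rfl, rfl⟩ | ⟨rfl, rfl⟩
      · exact ⟨hne, hab.le⟩
      · exact ⟨hne.symm, by rw [dist_comm]; exact hab.le⟩
    · rcases Finset.mem_union.1 h with h | h
      · exact hE.ne_and_dist_le u v h
      · exact hF.ne_and_dist_le u v h
  · set H := SimpleGraph.fromEdgeSet
      ((insert s(a, b) (E ∪ F) : Finset (Sym2 V)) : Set (Sym2 V)) with hH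
    have hEH : SimpleGraph.fromEdgeSet (E : Set (Sym2 V)) ≤ H :=
      SimpleGraph.fromEdgeSet_mono fun e he => by
        simp only [Finset.coe_insert, Finset.coe_union]; exact Or.inr (Or.inl he)
    have hFH : SimpleGraph.fromEdgeSet (F : Set (Sym2 V)) ≤ H :=
      SimpleGraph.fromEdgeSet_mono fun e he => by
        simp only [Finset.coe_insert, Finset.coe_union]; exact Or.inr (Or.inr he)
    have hHab : H.Reachable a b := SimpleGraph.Adj.reachable <| by
      rw [hH, SimpleGraph.fromEdgeSet_adj]; exact ⟨by simp, hne⟩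
    have hall : ∀ u ∈ ((P ∪ Q : Finset V) : Set V), H.Reachable u a := by
      intro u hu
      rcases Finset.mem_union.1 hu with h | h
      · exact (hE.reachable u h a ha).mono hEH
      · exact ((hF.reachable u h b hb).mono hFH).trans hHab.symm
    exact fun u hu v hv => (hall u hu).trans (hall v hv).symm
  · have hdisj : Disjoint (thickening (t / 2) (pos '' P)) (thickening (t / 2) (pos '' Q)) := by
      rw [Set.disjoint_left]
      intro x hx hy
      obtain ⟨_, ⟨u, hu, rfl⟩, hux⟩ := mem_thickening_iff.1 hx
      obtain ⟨_, ⟨v, hv, rfl⟩, hvx⟩ := mem_thickening_iff.1 hy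
      have := hsep u hu v hv
      have := dist_triangle_left (pos u) (pos v) x
      linarith
    have hfin (R : Finset V) : volume (thickening (t / 2) (pos '' R)) ≠ ⊤ := by
      have := volume_thickening_ne_top (R.image pos) (t / 2)
      rwa [Finset.coe_image] at this
    have hvol : volume.real (thickening (t / 2) (pos '' ((P ∪ Q : Finset V) : Set V))) =
        volume.real (thickening (t / 2) (pos '' P)) +
          volume.real (thickening (t / 2) (pos '' Q)) := by
      rw [Finset.coe_union, Set.image_union, thickening_union]
      exact measureReal_union hdisj isOpen_thickening.measurableSet (hfin P) (hfin Q)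
    have hsum : ∑ e ∈ insert s(a, b) (E ∪ F), linkWeight pos 2 e ≤
        t ^ 2 + (∑ e ∈ E, linkWeight pos 2 e + ∑ e ∈ F, linkWeight pos 2 e) := by
      rw [Finset.insert_eq]
      refine (Finset.sum_union_le (linkWeight_nonneg pos 2) _ _).trans ?_
      rw [Finset.sum_singleton, linkWeight_mk, hab, Real.rpow_two]
      have := Finset.sum_union_le (linkWeight_nonneg pos 2) E F
      linarith
    rw [hvol]
    have := mul_le_mul_of_nonneg_left hsum volume_real_unitBall_pos.le
    linarith

/-- Kruskal's algorithm, run from a partition into clusters at mutual distance at least `t`: merge a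
closest pair until one cluster is left. The node `c`, within distance `r` of all others, keeps every
merging distance at most `r`. -/
lemma hasLightLinks_biUnion {V : Type*} [DecidableEq V] (pos : V → EuclideanSpace ℝ (Fin 2))
    {r : ℝ} (n : ℕ) : ∀ (𝒞 : Finset (Finset V)) (t : ℝ), 𝒞.card = n + 1 → 0 ≤ t → t ≤ r →
    (∀ A ∈ 𝒞, A.Nonempty ∧ HasLightLinks pos A t) →
    (∀ A ∈ 𝒞, ∀ B ∈ 𝒞, A ≠ B → ∀ a ∈ A, ∀ b ∈ B, a ≠ b ∧ t ≤ dist (pos a) (pos b)) →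
    (∃ c ∈ 𝒞.biUnion id, ∀ v ∈ 𝒞.biUnion id, dist (pos c) (pos v) ≤ r) →
    HasLightLinks pos (𝒞.biUnion id) r := by
  induction n with
  | zero =>
    intro 𝒞 t hcard ht htr hC hsep _
    obtain ⟨A, rfl⟩ := Finset.card_eq_one.1 hcard
    have := hC A (by simp)
    simpa using this.2.mono this.1 ht htr
  | succ n ih =>
    intro 𝒞 t hcard ht htr hC hsep hc
    -- all pairs of nodes in different clusters
    set X : Finset (V × V) := 𝒞.offDiag.biUnion fun p => p.1 ×ˢ p.2 with hX
    have hmX : ∀ a b, (a, b) ∈ X ↔ ∃ A ∈ 𝒞, ∃ B ∈ 𝒞, A ≠ B ∧ a ∈ A ∧ b ∈ B := by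
      intro a b
      simp only [hX, Finset.mem_biUnion, Finset.mem_offDiag, Finset.mem_product, Prod.exists]
      constructor
      · rintro ⟨A, B, ⟨hA, hB, hAB⟩, ha, hb⟩
        exact ⟨A, hA, B, hB, hAB, ha, hb⟩
      · rintro ⟨A, hA, B, hB, hAB, ha, hb⟩
        exact ⟨A, B, ⟨hA, hB, hAB⟩, ha, hb⟩
    obtain ⟨c, hcm, hcr⟩ := hc
    obtain ⟨C, hCm, hcC⟩ := Finset.mem_biUnion.1 hcm
    obtain ⟨D, hDm, hDC⟩ := Finset.exists_mem_ne (by omega : 1 < 𝒞.card) C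
    obtain ⟨d, hd⟩ := (hC D hDm).1
    have hcd : (c, d) ∈ X := (hmX c d).2 ⟨C, hCm, D, hDm, hDC.symm, hcC, hd⟩
    obtain ⟨⟨a, b⟩, hab, hmin⟩ :=
      X.exists_min_image (fun p => dist (pos p.1) (pos p.2)) ⟨_, hcd⟩
    obtain ⟨A, hA, B, hB, hAB, ha, hb⟩ := (hmX a b).1 hab
    set t' := dist (pos a) (pos b) with ht'
    have htt' : t ≤ t' := (hsep A hA B hB hAB a ha b hb).2
    have ht'r : t' ≤ r := (hmin _ hcd).trans (hcr d (Finset.mem_biUnion.2 ⟨D, hDm, hd⟩))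
    have hsep' : ∀ A ∈ 𝒞, ∀ B ∈ 𝒞, A ≠ B → ∀ a ∈ A, ∀ b ∈ B,
        a ≠ b ∧ t' ≤ dist (pos a) (pos b) := fun A hA B hB hAB a ha b hb =>
      ⟨(hsep A hA B hB hAB a ha b hb).1, hmin (a, b) ((hmX a b).2 ⟨A, hA, B, hB, hAB, ha, hb⟩)⟩
    have hC' : ∀ A ∈ 𝒞, A.Nonempty ∧ HasLightLinks pos A t' := fun A hA =>
      ⟨(hC A hA).1, (hC A hA).2.mono (hC A hA).1 ht htt'⟩
    set 𝒟 := (𝒞.erase A).erase B with h𝒟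
    have hBA : B ∈ 𝒞.erase A := Finset.mem_erase.2 ⟨hAB.symm, hB⟩
    have hm𝒟 : ∀ F ∈ 𝒟, F ≠ B ∧ F ≠ A ∧ F ∈ 𝒞 := by simp [h𝒟]
    have hunion : (insert (A ∪ B) 𝒟).biUnion id = 𝒞.biUnion id := by
      conv_rhs => rw [← Finset.insert_erase hA, ← Finset.insert_erase hBA]
      simp [Finset.biUnion_insert, h𝒟, Finset.union_assoc]
    have hnot : A ∪ B ∉ 𝒟 := fun h => by
      obtain ⟨-, h2, h3⟩ := hm𝒟 _ h
      exact (hsep _ h3 A hA h2 a (Finset.mem_union_left _ ha) a ha).1 rfl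
    rw [← hunion]
    refine ih _ t' ?_ (ht.trans htt') ht'r ?_ ?_ ?_
    · rw [Finset.card_insert_of_notMem hnot, h𝒟, Finset.card_erase_of_mem hBA,
        Finset.card_erase_of_mem hA]
      omega
    · intro F hF
      rcases Finset.mem_insert.1 hF with rfl | hF
      · exact ⟨⟨a, Finset.mem_union_left _ ha⟩, (hC' A hA).2.union (hC' B hB).2
          (fun u hu v hv => (hsep' A hA B hB hAB u hu v hv).2) ha hb
          (hsep A hA B hB hAB a ha b hb).1 rfl⟩
      · exact hC' F (hm𝒟 F hF).2.2
    · have haux : ∀ F ∈ 𝒟, ∀ u ∈ A ∪ B, ∀ v ∈ F, u ≠ v ∧ t' ≤ dist (pos u) (pos v) := by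
        intro F hF u hu v hv
        obtain ⟨h1, h2, h3⟩ := hm𝒟 F hF
        rcases Finset.mem_union.1 hu with hu | hu
        · exact hsep' A hA F h3 h2.symm u hu v hv
        · exact hsep' B hB F h3 h1.symm u hu v hv
      intro F hF F' hF' hne u hu v hv
      rcases Finset.mem_insert.1 hF with rfl | hF <;> rcases Finset.mem_insert.1 hF' with rfl | hF'
      · exact absurd rfl hne
      · exact haux F' hF' u hu v hv
      · obtain ⟨h1, h2⟩ := haux F hF v hv u hu
        exact ⟨h1.symm, by rwa [dist_comm]⟩
      · exact hsep' F (hm𝒟 F hF).2.2 F' (hm𝒟 F' hF').2.2 hne u hu v hv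
    · rw [hunion]
      exact ⟨c, hcm, hcr⟩

/-- Finitely many points in a disc of radius `r` around one of them can be joined by links whose
squared lengths sum up to at most `8 * r ^ 2`: their `r / 2`-neighbourhood lies in a disc of radius
`3 * r / 2`, so that four times its area is that of nine discs of radius `r`, one of which is
subtracted. -/
lemma exists_links_sum_sq_le {V : Type*} (pos : V → EuclideanSpace ℝ (Fin 2)) {P : Finset V}
    {c : V} (hc : c ∈ P) {r : ℝ} (hr : ∀ v ∈ P, dist (pos c) (pos v) ≤ r) :
    ∃ E : Finset (Sym2 V), LinksCluster pos P r E ∧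
      ∑ e ∈ E, linkWeight pos 2 e ≤ 8 * r ^ 2 := by
  classical
  have hr0 : 0 ≤ r := dist_nonneg.trans (hr c hc)
  have hP : (P.image fun v => ({v} : Finset V)).biUnion id = P := by
    ext v; simp
  have hcard : (P.image fun v => ({v} : Finset V)).card = (P.card - 1) + 1 := by
    rw [Finset.card_image_of_injective _ Finset.singleton_injective]
    have := Finset.card_pos.2 ⟨c, hc⟩
    omega
  have key := hasLightLinks_biUnion pos (r := r) _ _ 0 hcard le_rfl hr0
    (by
      intro A hA
      obtain ⟨v, -, rfl⟩ := Finset.mem_image.1 hA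
      exact ⟨Finset.singleton_nonempty v, hasLightLinks_singleton pos v⟩)
    (by
      intro A hA B hB hAB a ha b hb
      obtain ⟨u, -, rfl⟩ := Finset.mem_image.1 hA
      obtain ⟨v, -, rfl⟩ := Finset.mem_image.1 hB
      rw [Finset.mem_singleton] at ha hb
      subst ha hb
      exact ⟨fun h => hAB (by rw [h]), dist_nonneg⟩)
    (by rw [hP]; exact ⟨c, hc, hr⟩)
  rw [hP] at key
  obtain ⟨E, hE, hb⟩ := key
  refine ⟨E, hE, ?_⟩
  have hsub : thickening (r / 2) (pos '' P) ⊆ ball (pos c) (3 * r / 2) := by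
    intro x hx
    obtain ⟨_, ⟨v, hv, rfl⟩, hvx⟩ := mem_thickening_iff.1 hx
    rw [mem_ball]
    have := dist_triangle_right x (pos c) (pos v)
    have := hr v hv
    linarith
  have hvol := measureReal_mono (μ := volume) hsub measure_ball_lt_top.ne
  rw [volume_real_ball _ (by linarith)] at hvol
  have : volume.real (ball (0 : EuclideanSpace ℝ (Fin 2)) 1) *
      (∑ e ∈ E, linkWeight pos 2 e + r ^ 2) ≤
      volume.real (ball (0 : EuclideanSpace ℝ (Fin 2)) 1) * (9 * r ^ 2) := by
    linarith
  linarith [le_of_mul_le_mul_left this volume_real_unitBall_pos]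

/-- The same bound for the weights `d ^ α`, as `d ^ α ≤ d ^ 2 * r ^ (α - 2)` for `d ≤ r`. -/
lemma exists_links_sum_linkWeight_le {V : Type*} (pos : V → EuclideanSpace ℝ (Fin 2))
    {P : Finset V} {c : V} (hc : c ∈ P) {r : ℝ} (hr : ∀ v ∈ P, dist (pos c) (pos v) ≤ r)
    {α : ℝ} (hα : 2 ≤ α) :
    ∃ E : Finset (Sym2 V), LinksCluster pos P r E ∧
      ∑ e ∈ E, linkWeight pos α e ≤ 8 * r ^ α := by
  have hr0 : 0 ≤ r := dist_nonneg.trans (hr c hc)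
  have hsplit {d : ℝ} (hd : 0 ≤ d) : d ^ α = d ^ (2 : ℝ) * d ^ (α - 2) := by
    rw [← Real.rpow_add_of_nonneg hd (by norm_num) (by linarith)]
    congr 1
    ring
  obtain ⟨E, hE, hb⟩ := exists_links_sum_sq_le pos hc hr
  refine ⟨E, hE, ?_⟩
  have hle : ∀ e ∈ E, linkWeight pos α e ≤ linkWeight pos 2 e * r ^ (α - 2) := by
    intro e he
    induction e with
    | _ u v =>
      rw [linkWeight_mk, linkWeight_mk, hsplit dist_nonneg]
      exact mul_le_mul_of_nonneg_left (Real.rpow_le_rpow dist_nonneg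
        (hE.ne_and_dist_le u v he).2 (by linarith)) (Real.rpow_nonneg dist_nonneg _)
  calc ∑ e ∈ E, linkWeight pos α e ≤ ∑ e ∈ E, linkWeight pos 2 e * r ^ (α - 2) :=
        Finset.sum_le_sum hle
    _ = (∑ e ∈ E, linkWeight pos 2 e) * r ^ (α - 2) := by rw [Finset.sum_mul]
    _ ≤ 8 * r ^ 2 * r ^ (α - 2) :=
        mul_le_mul_of_nonneg_right hb (Real.rpow_nonneg hr0 _)
    _ = 8 * r ^ α := by rw [hsplit hr0, Real.rpow_two, mul_assoc]

/-! ### Powers and weights of trees -/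

lemma exists_max_txEnergy {V : Type*} [Finite V] {G : SimpleGraph V}
    (pos : V → EuclideanSpace ℝ (Fin 2)) {α : ℝ} (hα : 0 < α) {T : G.Subgraph} {u : V}
    (hu : u ∈ internalNodes T) :
    ∃ v, T.Adj u v ∧ nodePower pos α T u = txEnergy pos α u v ∧
      ∀ w, T.Adj u w → dist (pos u) (pos w) ≤ dist (pos u) (pos v) := by
  have hne : (T.neighborSet u).Nonempty := by
    rw [Set.nonempty_iff_ne_empty]
    intro h
    simp [internalNodes, h] at hu
  have hfin : (txEnergy pos α u '' T.neighborSet u).Finite := (Set.toFinite _).image _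
  obtain ⟨v, hv, hmax⟩ := (hne.image (txEnergy pos α u)).csSup_mem hfin
  refine ⟨v, hv, hmax.symm, fun w hw => ?_⟩
  have : txEnergy pos α u w ≤ txEnergy pos α u v := by
    rw [hmax]
    exact le_csSup hfin.bddAbove ⟨w, hw, rfl⟩
  exact (Real.rpow_le_rpow_iff dist_nonneg dist_nonneg hα).1 this

lemma nodePower_nonneg {V : Type*} {G : SimpleGraph V}
    (pos : V → EuclideanSpace ℝ (Fin 2)) (α : ℝ) (T : G.Subgraph) (u : V) :
    0 ≤ nodePower pos α T u := by
  refine Real.sSup_nonneg ?_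
  rintro _ ⟨v, -, rfl⟩
  exact Real.rpow_nonneg dist_nonneg _

lemma totalPower_nonneg {V : Type*} [Fintype V] {G : SimpleGraph V}
    (pos : V → EuclideanSpace ℝ (Fin 2)) (α : ℝ) (T : G.Subgraph) :
    0 ≤ totalPower pos α T :=
  Finset.sum_nonneg fun u _ => nodePower_nonneg pos α T u

/-- The power of a node is the weight of one of its links, and each link has two ends. -/
lemma totalPower_le_two_mul_treeWeight {V : Type*} [Fintype V] {G : SimpleGraph V}
    (pos : V → EuclideanSpace ℝ (Fin 2)) {α : ℝ} (hα : 0 < α) (T : G.Subgraph) :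
    totalPower pos α T ≤ 2 * treeWeight pos α T := by
  classical
  have hnode : ∀ u ∈ (internalNodes T).toFinset,
      nodePower pos α T u ≤ ∑ e ∈ T.edgeSet.toFinset with u ∈ e, linkWeight pos α e := by
    intro u hu
    obtain ⟨v, hv, hp, -⟩ := exists_max_txEnergy pos hα (Set.mem_toFinset.1 hu)
    rw [hp]
    exact Finset.single_le_sum (f := linkWeight pos α) (a := s(u, v))
      (fun e _ => linkWeight_nonneg pos α e)
      (by simpa using hv)
  calc totalPower pos α T
      ≤ ∑ u ∈ (internalNodes T).toFinset,
          ∑ e ∈ T.edgeSet.toFinset with u ∈ e, linkWeight pos α e := by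
        unfold totalPower
        convert Finset.sum_le_sum hnode
    _ ≤ ∑ u : V, ∑ e ∈ T.edgeSet.toFinset with u ∈ e, linkWeight pos α e :=
        Finset.sum_le_univ_sum_of_nonneg fun u =>
          Finset.sum_nonneg fun e _ => linkWeight_nonneg pos α e
    _ = ∑ e ∈ T.edgeSet.toFinset, ∑ u ∈ e.toFinset, linkWeight pos α e :=
        Finset.sum_comm' (by simp [and_comm])
    _ ≤ ∑ e ∈ T.edgeSet.toFinset, 2 * linkWeight pos α e := by
        refine Finset.sum_le_sum fun e _ => ?_
        rw [Finset.sum_const, nsmul_eq_mul]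
        refine mul_le_mul_of_nonneg_right ?_ (linkWeight_nonneg pos α e)
        rw [Sym2.card_toFinset]
        split_ifs <;> norm_num
    _ = 2 * treeWeight pos α T := by
        rw [← Finset.mul_sum]
        unfold treeWeight
        congr!

/-! ### Trees through the group -/

/-- A set of links that joins all nodes of `M` contains the links of a tree through `M`. -/
lemma exists_isMulticastTree_treeWeight_le {V : Type*} [Fintype V] {G : SimpleGraph V}
    (pos : V → EuclideanSpace ℝ (Fin 2)) (α : ℝ) {M : Set V} {E : Finset (Sym2 V)}
    (hE : (E : Set (Sym2 V)) ⊆ G.edgeSet) {c : V}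
    (hM : ∀ v ∈ M, (SimpleGraph.fromEdgeSet (E : Set (Sym2 V))).Reachable v c) :
    ∃ T : G.Subgraph, IsMulticastTree M T ∧
      treeWeight pos α T ≤ ∑ e ∈ E, linkWeight pos α e := by
  classical
  set H := SimpleGraph.fromEdgeSet (E : Set (Sym2 V)) with hH
  obtain ⟨T₀, hle, hT₀⟩ :=
    (H.connectedComponentMk c).connected_toSimpleGraph.exists_isTree_le
  have hadj : ∀ {u v : (H.connectedComponentMk c)}, T₀.Adj u v → s((u : V), (v : V)) ∈ E := by
    intro u v h
    have h' : H.Adj u v := hle h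
    exact ((SimpleGraph.fromEdgeSet_adj _).1 h').1
  set T : G.Subgraph :=
    { verts := (H.connectedComponentMk c).supp
      Adj := fun u v => ∃ (hu : u ∈ (H.connectedComponentMk c).supp)
        (hv : v ∈ (H.connectedComponentMk c).supp), T₀.Adj ⟨u, hu⟩ ⟨v, hv⟩
      adj_sub := fun ⟨hu, hv, h⟩ => hE (hadj h)
      edge_vert := fun ⟨hu, hv, h⟩ => hu
      symm := ⟨fun u v ⟨hu, hv, h⟩ => ⟨hv, hu, h.symm⟩⟩ } with hT
  refine ⟨T, ⟨?_, ?_⟩, ?_⟩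
  · have : T.coe = T₀ := by
      ext u v
      exact ⟨fun ⟨_, _, h⟩ => h, fun h => ⟨u.2, v.2, h⟩⟩
    rw [this]
    exact hT₀
  · exact fun v hv => SimpleGraph.ConnectedComponent.sound (hM v hv)
  · refine Finset.sum_le_sum_of_subset_of_nonneg ?_ fun e _ _ => linkWeight_nonneg pos α e
    intro e he
    rw [Set.mem_toFinset] at he
    induction e with
    | _ u v =>
      obtain ⟨hu, hv, h⟩ := he
      exact hadj h

/-- If both ends of a link of a connected subgraph have no other neighbour, the subgraph consists of
that link. -/
lemma verts_subset_pair {V : Type*} [Finite V] {G : SimpleGraph V} {T : G.Subgraph}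
    (hT : T.coe.Connected) {x y : V} (hxy : T.Adj x y) (hx : x ∉ internalNodes T)
    (hy : y ∉ internalNodes T) : T.verts ⊆ {x, y} := by
  have honly : ∀ {a b : V}, a ∉ internalNodes T → T.Adj a b → ∀ w, T.Adj a w → w = b := by
    intro a b ha hab w haw
    exact (Set.ncard_le_one (Set.toFinite _)).1 (not_lt.1 ha) w haw b hab
  intro v hv
  have hreach := hT.preconnected ⟨x, T.edge_vert hxy⟩ ⟨v, hv⟩
  rw [SimpleGraph.reachable_iff_reflTransGen] at hreach
  have : ∀ w : T.verts, Relation.ReflTransGen T.coe.Adj ⟨x, T.edge_vert hxy⟩ w →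
      (w : V) = x ∨ (w : V) = y := by
    intro w hw
    induction hw with
    | refl => exact Or.inl rfl
    | @tail b d _ hbd ih =>
      have hbd' : T.Adj b d := hbd
      rcases ih with h | h <;> rw [h] at hbd'
      · exact Or.inr (honly hx hxy _ hbd')
      · exact Or.inl (honly hy hxy.symm _ hbd')
  exact this _ hreach

lemma Finset.sum_biUnion_le {ι κ : Type*} [DecidableEq κ] {f : κ → ℝ}
    (hf : ∀ k, 0 ≤ f k) (s : Finset ι) (t : ι → Finset κ) :
    ∑ k ∈ s.biUnion t, f k ≤ ∑ i ∈ s, ∑ k ∈ t i, f k := by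
  classical
  induction s using Finset.induction_on with
  | empty => simp
  | insert a s ha ih =>
    rw [Finset.biUnion_insert, Finset.sum_insert ha]
    exact (Finset.sum_union_le hf _ _).trans (by linarith)

/-- Each internal node `u` and its neighbours can be joined by links of weight at most `8 * λ(u)`,
none longer than a link of `T` at `u` and hence all in `G`. If every link of `T` has an internal
end, these links together reach everything that `T` reaches. -/
lemma exists_treeWeight_le_totalPower {V : Type*} [Fintype V] {G : SimpleGraph V}
    {pos : V → EuclideanSpace ℝ (Fin 2)} (hG : IsRangeGraph G pos) {α : ℝ} (hα : 2 ≤ α)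
    {M : Set V} {T : G.Subgraph} (hT : IsMulticastTree M T)
    (hend : ∀ x y, T.Adj x y → x ∈ internalNodes T ∨ y ∈ internalNodes T) :
    ∃ T' : G.Subgraph, IsMulticastTree M T' ∧
      treeWeight pos α T' ≤ 8 * totalPower pos α T := by
  classical
  have hstar : ∀ u ∈ internalNodes T, ∃ E : Finset (Sym2 V),
      (E : Set (Sym2 V)) ⊆ G.edgeSet ∧
      (∀ v, T.Adj u v → (SimpleGraph.fromEdgeSet (E : Set (Sym2 V))).Reachable u v) ∧
      ∑ e ∈ E, linkWeight pos α e ≤ 8 * nodePower pos α T u := by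
    intro u hu
    obtain ⟨R, hR⟩ := hG
    obtain ⟨v, huv, hp, hmax⟩ := exists_max_txEnergy pos (by linarith : 0 < α) hu
    obtain ⟨E, hE, hb⟩ := exists_links_sum_linkWeight_le pos (c := u)
      (P := insert u (Finset.univ.filter fun w => T.Adj u w)) (Finset.mem_insert_self _ _)
      (r := dist (pos u) (pos v)) (by
        intro w hw
        rcases Finset.mem_insert.1 hw with rfl | hw
        · rw [dist_self]; exact dist_nonneg
        · exact hmax w (Finset.mem_filter.1 hw).2) hα
    refine ⟨E, ?_, ?_, by rw [hp]; exact hb⟩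
    · intro e he
      induction e with
      | _ a b =>
        obtain ⟨h1, h2⟩ := hE.ne_and_dist_le a b he
        exact (hR a b).2 ⟨h1, h2.trans ((hR u v).1 (T.adj_sub huv)).2⟩
    · intro w hw
      refine hE.reachable u (by simp) w ?_
      simp [hw]
  choose! E hEG hEr hEb using hstar
  set F := (internalNodes T).toFinset.biUnion E with hF
  have hmono : ∀ u ∈ internalNodes T, SimpleGraph.fromEdgeSet (E u : Set (Sym2 V)) ≤
      SimpleGraph.fromEdgeSet (F : Set (Sym2 V)) := fun u hu =>
    SimpleGraph.fromEdgeSet_mono (Finset.coe_subset.2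
      (Finset.subset_biUnion_of_mem E (Set.mem_toFinset.2 hu)))
  have hstep : ∀ x y, T.Adj x y → (SimpleGraph.fromEdgeSet (F : Set (Sym2 V))).Reachable x y := by
    intro x y hxy
    rcases hend x y hxy with h | h
    · exact (hEr x h y hxy).mono (hmono x h)
    · exact ((hEr y h x hxy.symm).mono (hmono y h)).symm
  obtain ⟨c, hc⟩ := hT.1.connected.nonempty
  have hreach : ∀ v ∈ T.verts, (SimpleGraph.fromEdgeSet (F : Set (Sym2 V))).Reachable v c := by
    intro v hv
    obtain ⟨w⟩ := hT.1.connected.preconnected ⟨v, hv⟩ ⟨c, hc⟩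
    have : ∀ {a b : T.verts}, T.coe.Walk a b →
        (SimpleGraph.fromEdgeSet (F : Set (Sym2 V))).Reachable (a : V) b := by
      intro a b p
      induction p with
      | nil => exact SimpleGraph.Reachable.refl _
      | cons h _ ih => exact (hstep _ _ h).trans ih
    exact this w
  obtain ⟨T', hT', hw⟩ := exists_isMulticastTree_treeWeight_le (G := G) pos α (M := M) (E := F)
    (by
      intro e he
      obtain ⟨u, hu, heu⟩ := Finset.mem_biUnion.1 (Finset.mem_coe.1 he)
      exact hEG u (Set.mem_toFinset.1 hu) heu)
    fun v hv => hreach v (hT.2 hv)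
  refine ⟨T', hT', hw.trans ?_⟩
  calc ∑ e ∈ F, linkWeight pos α e
      ≤ ∑ u ∈ (internalNodes T).toFinset, ∑ e ∈ E u, linkWeight pos α e :=
        Finset.sum_biUnion_le (linkWeight_nonneg pos α) _ _
    _ ≤ ∑ u ∈ (internalNodes T).toFinset, 8 * nodePower pos α T u :=
        Finset.sum_le_sum fun u hu => hEb u (Set.mem_toFinset.1 hu)
    _ = 8 * totalPower pos α T := by
        rw [← Finset.mul_sum]
        unfold totalPower
        congr!

theorem lemma5 {V : Type*} [Fintype V] (G : SimpleGraph V)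
    (pos : V → EuclideanSpace ℝ (Fin 2)) (hG : IsRangeGraph G pos)
    (α : ℝ) (hα : 2 ≤ α) (M : Set V) (hM : ∀ u v : V, G.Adj u v → M ≠ {u, v})
    (TS TW : G.Subgraph) (hTS : IsTwoApproxSteinerTree pos α M TS)
    (hTW : IsMinPowerTree pos α M TW) :
    totalPower pos α TS ≤ 48 * totalPower pos α TW := by
  have h0 := totalPower_nonneg pos α TW
  obtain ⟨T, hT, hw⟩ : ∃ T : G.Subgraph, IsMulticastTree M T ∧
      treeWeight pos α T ≤ 8 * totalPower pos α TW := by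
    by_cases hend : ∀ x y, TW.Adj x y → x ∈ internalNodes TW ∨ y ∈ internalNodes TW
    · exact exists_treeWeight_le_totalPower hG hα hTW.1 hend
    · -- `TW` is a single link, and `M` misses one of its ends: one node serves as the tree.
      push Not at hend
      obtain ⟨x, y, hxy, hx, hy⟩ := hend
      have hsub : M ⊆ {x, y} :=
        hTW.1.2.trans (verts_subset_pair hTW.1.1.connected hxy hx hy)
      obtain ⟨c, hc⟩ : ∃ c, M ⊆ {c} := by
        by_cases hxM : x ∈ M
        · refine ⟨x, fun v hv => ?_⟩
          rcases hsub hv with h | h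
          · exact h
          · refine absurd (hsub.antisymm ?_) (hM x y (TW.adj_sub hxy))
            rintro z (rfl | rfl)
            · exact hxM
            · exact h ▸ hv
        · refine ⟨y, fun v hv => ?_⟩
          rcases hsub hv with h | h
          · exact absurd (h ▸ hv) hxM
          · exact h
      obtain ⟨T, hT, hw⟩ := exists_isMulticastTree_treeWeight_le (G := G) pos α (M := M) (E := ∅)
        (c := c) (by simp) fun v hv => by rw [hc hv]
      rw [Finset.sum_empty] at hw
      exact ⟨T, hT, by linarith⟩
  have h1 := totalPower_le_two_mul_treeWeight pos (by linarith : 0 < α) TS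
  have h2 := hTS.2 T hT
  linarith
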